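/- \textbf{Conventions.} Operator spaces are complete: an operator space is a complex Banach space $E$ with norms $\|\cdot\|_n$ on all $M_n(E)$ (with $\|\cdot\|_1$ the given norm) satisfying Ruan's axioms $\|\alpha x\beta\|_m\le\|\alpha\|\,\|x\|_n\,\|\beta\|$ (for $x\in M_n(E)$ and scalar matrices $\alpha\in M_{m,n}$, $\beta\in M_{n,m}$) and $\|x\oplus y\|_{m+n}=\max\{\|x\|_m,\|y\|_n\}$. $\mathrm{Op}_\infty$ is the category of operator spaces and completely bounded linear maps (not only complete contractions). Let $A$ be a unital operator algebra, that is, a unital Banach algebra with contractive unit and an operator space structure such that the multiplication is completely contractive on the Haagerup tensor product, i.e. $\|ab\|_n\le\|a\|_n\|b\|_n$ for all $a,b\in M_n(A)$. An operator space $E$ that is a unital right $A$-module is a \emph{right operator $A$-module} if the action induces a complete contraction $E\otimes_h A\to E$ on the Haagerup tensor product, i.e. $\bigl\|\bigl[\sum_k x_{ik}\cdot a_{kj}\bigr]\bigr\|_n\le\|x\|_n\|a\|_n$ for all $n$, $x\in M_n(E)$, $a\in M_n(A)$; it is a \emph{matrix normed right $A$-module} if the action induces a complete contraction on the operator space projective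 tensor product of $E$ and $A$, i.e. $\|[x_{ij}\cdot a_{kl}]\|_{nm}\le\|x\|_n\|a\|_m$ for all $n,m$, $x\in M_n(E)$, $a\in M_m(A)$. Let $\mathrm{OMOD}^\infty_A$ and $\mathrm{mnMOD}^\infty_A$ be the categories of these modules, with completely bounded $A$-module maps as morphisms. In an additive category, $\mathcal{E}_{\max}$ is the class of all kernel-cokernel pairs, that is, of composable pairs $(\mu,\pi)$ where $\mu$ is a kernel of $\pi$ and $\pi$ is a cokernel of $\mu$. In $\mathrm{OMOD}^\infty_A$ and $\mathrm{mnMOD}^\infty_A$, $\mathcal{E}_{\mathrm{rel}}\subseteq\mathcal{E}_{\max}$ is the class of those kernel-cokernel pairs $K\xrightarrow{\mu}F\xrightarrow{\pi}C$ that split in $\mathrm{Op}_\infty$: there are completely bounded linear maps $r\colon F\to K$ and $s\colon C\to F$ with $r\mu=\mathrm{id}_K$, $\pi s=\mathrm{id}_C$ and $\mu r+s\pi=\mathrm{id}_F$. For a class $\mathcal{E}$ of kernel-cokernel pairs, $\mu$ is an \emph{admissible monomorphism} if $(\mu,\pi)\in\mathcal{E}$ for some $\pi$, and an object $I$ is \emph{$\mathcal{E}$-injective}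 if for every admissible monomorphism $\mu\colon X\to Y$ and every morphism $f\colon X\to I$ there is a morphism $g\colon Y\to I$ with $g\mu=f$. \textbf{Proposition.} Let $A$ be a unital operator algebra and let $\mathcal{A}$ be either $\mathrm{OMOD}^\infty_A$ or $\mathrm{mnMOD}^\infty_A$. Let $E\in\mathcal{A}$. If $E$ is $\mathcal{E}_{\mathrm{rel}}$-injective in $\mathcal{A}$ and, regarded as an operator space, $\mathcal{E}_{\max}$-injective in $\mathrm{Op}_\infty$, then $E$ is $\mathcal{E}_{\max}$-injective in $\mathcal{A}$. -/

import Mathlib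

open CategoryTheory CategoryTheory.Limits

universe u v

/-! ## Operator spaces -/

/-- The product `α x β` of scalar matrices `α`, `β` with a matrix `x` over a complex vector space. -/
def scalarSandwich {E : Type*} [AddCommGroup E] [Module ℂ E] {m n : ℕ}
    (α : Matrix (Fin m) (Fin n) ℂ) (x : Matrix (Fin n) (Fin n) E)
    (β : Matrix (Fin n) (Fin m) ℂ) : Matrix (Fin m) (Fin m) E :=
  Matrix.of fun i j => ∑ k, ∑ l, (α i k * β l j) • x k l

/-- The block diagonal matrix `x ⊕ y`. -/
def blockDiag {E : Type*} [Zero E] {m n : ℕ}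
    (x : Matrix (Fin m) (Fin m) E) (y : Matrix (Fin n) (Fin n) E) :
    Matrix (Fin (m + n)) (Fin (m + n)) E :=
  Matrix.reindex finSumFinEquiv finSumFinEquiv (Matrix.fromBlocks x 0 0 y)

open scoped Matrix.Norms.L2Operator in
/-- Matrix norms on a complex normed space subject to Ruan's axioms; scalar matrices carry the
operator norm between the Euclidean spaces `ℂⁿ`. (Completeness is a separate assumption.) -/
class OperatorSpace (E : Type*) [NormedAddCommGroup E] [NormedSpace ℂ E] where
  /-- The norm of `M_n(E)`. -/
  mnorm : ∀ n : ℕ, Seminorm ℂ (Matrix (Fin n) (Fin n) E)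
  mnorm_one : ∀ x : E, mnorm 1 (Matrix.of fun _ _ => x) = ‖x‖
  mnorm_sandwich_le : ∀ (m n : ℕ) (α : Matrix (Fin m) (Fin n) ℂ) (x : Matrix (Fin n) (Fin n) E)
    (β : Matrix (Fin n) (Fin m) ℂ),
    mnorm m (scalarSandwich α x β) ≤ ‖α‖ * mnorm n x * ‖β‖
  mnorm_blockDiag : ∀ (m n : ℕ) (x : Matrix (Fin m) (Fin m) E) (y : Matrix (Fin n) (Fin n) E),
    mnorm (m + n) (blockDiag x y) = max (mnorm m x) (mnorm n y)

open OperatorSpace (mnorm)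

/-- A linear map `f` is completely bounded if its amplifications `f_n` to `M_n(E)` are uniformly
bounded. -/
def IsCompletelyBounded {E F : Type*} [NormedAddCommGroup E] [NormedSpace ℂ E] [OperatorSpace E]
    [NormedAddCommGroup F] [NormedSpace ℂ F] [OperatorSpace F] (f : E →ₗ[ℂ] F) : Prop :=
  ∃ C : ℝ, ∀ (n : ℕ) (x : Matrix (Fin n) (Fin n) E), mnorm n (x.map f) ≤ C * mnorm n x

section CompletelyBounded

variable {E F G : Type*} [NormedAddCommGroup E] [NormedSpace ℂ E] [OperatorSpace E]
  [NormedAddCommGroup F] [NormedSpace ℂ F] [OperatorSpace F]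
  [NormedAddCommGroup G] [NormedSpace ℂ G] [OperatorSpace G]

theorem IsCompletelyBounded.id : IsCompletelyBounded (LinearMap.id : E →ₗ[ℂ] E) :=
  ⟨1, fun n x => by
    rw [one_mul]
    exact le_of_eq (congrArg (mnorm n) (Matrix.ext fun _ _ => rfl))⟩

theorem IsCompletelyBounded.comp {g : F →ₗ[ℂ] G} {f : E →ₗ[ℂ] F}
    (hg : IsCompletelyBounded g) (hf : IsCompletelyBounded f) :
    IsCompletelyBounded (g ∘ₗ f) := by
  obtain ⟨C, hC⟩ := hg
  obtain ⟨D, hD⟩ := hf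
  refine ⟨|C| * D, fun n x => ?_⟩
  have h1 : x.map (g ∘ₗ f) = (x.map f).map g := rfl
  rw [h1]
  calc mnorm n ((x.map f).map g) ≤ C * mnorm n (x.map f) := hC n _
    _ ≤ |C| * mnorm n (x.map f) :=
        mul_le_mul_of_nonneg_right (le_abs_self C) (apply_nonneg _ _)
    _ ≤ |C| * (D * mnorm n x) := mul_le_mul_of_nonneg_left (hD n x) (abs_nonneg C)
    _ = |C| * D * mnorm n x := by ring

theorem IsCompletelyBounded.zero : IsCompletelyBounded (0 : E →ₗ[ℂ] F) :=
  ⟨0, fun n x => by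
    have h : x.map (0 : E →ₗ[ℂ] F) = 0 := Matrix.ext fun _ _ => rfl
    rw [h, map_zero, zero_mul]⟩

theorem IsCompletelyBounded.add {f g : E →ₗ[ℂ] F}
    (hf : IsCompletelyBounded f) (hg : IsCompletelyBounded g) : IsCompletelyBounded (f + g) := by
  obtain ⟨C, hC⟩ := hf
  obtain ⟨D, hD⟩ := hg
  refine ⟨C + D, fun n x => ?_⟩
  have h : x.map (f + g : E →ₗ[ℂ] F) = x.map f + x.map g := Matrix.ext fun _ _ => rfl
  rw [h, add_mul]
  exact (map_add_le_add _ _ _).trans (add_le_add (hC n x) (hD n x))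

theorem IsCompletelyBounded.smul (c : ℂ) {f : E →ₗ[ℂ] F} (hf : IsCompletelyBounded f) :
    IsCompletelyBounded (c • f) := by
  obtain ⟨C, hC⟩ := hf
  refine ⟨‖c‖ * C, fun n x => ?_⟩
  have h : x.map (c • f : E →ₗ[ℂ] F) = c • x.map f := Matrix.ext fun _ _ => rfl
  rw [h, map_smul_eq_mul, mul_assoc]
  exact mul_le_mul_of_nonneg_left (hC n x) (norm_nonneg c)

variable (E F) in
/-- `CB(E, F)`, the completely bounded linear maps. -/
def cbMaps : Submodule ℂ (E →ₗ[ℂ] F) where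
  carrier := {f | IsCompletelyBounded f}
  add_mem' := IsCompletelyBounded.add
  zero_mem' := IsCompletelyBounded.zero
  smul_mem' c _ := IsCompletelyBounded.smul c

variable (A : Type*) [Ring A] (E F) in
/-- `CB_A(E, F)`, the completely bounded maps between right `A`-modules that are `A`-linear. -/
def cbModuleMaps [Module Aᵐᵒᵖ E] [Module Aᵐᵒᵖ F] [SMulCommClass ℂ Aᵐᵒᵖ F] :
    Submodule ℂ (E →ₗ[ℂ] F) where
  carrier := {f | IsCompletelyBounded f ∧
    ∀ (a : A) (x : E), f (MulOpposite.op a • x) = MulOpposite.op a • f x}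
  add_mem' hf hg := ⟨hf.1.add hg.1, fun a x => by
    simp only [LinearMap.add_apply, smul_add, hf.2 a x, hg.2 a x]⟩
  zero_mem' := ⟨IsCompletelyBounded.zero, fun a x => by simp⟩
  smul_mem' c _ hf := ⟨hf.1.smul c, fun a x => by
    rw [LinearMap.smul_apply, LinearMap.smul_apply, hf.2 a x, smul_comm]⟩

end CompletelyBounded

/-- Objects of `Op_∞`: the complete operator spaces. -/
structure OpSpace where
  /-- The underlying Banach space. -/
  carrier : Type v
  [normedAddCommGroup : NormedAddCommGroup carrier]
  [normedSpace : NormedSpace ℂ carrier]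
  [completeSpace : CompleteSpace carrier]
  [operatorSpace : OperatorSpace carrier]

attribute [instance] OpSpace.normedAddCommGroup OpSpace.normedSpace OpSpace.completeSpace
  OpSpace.operatorSpace

/-- The category `Op_∞`: its morphisms are all completely bounded linear maps. -/
instance OpSpace.category : Category.{v} OpSpace.{v} where
  Hom E F := cbMaps E.carrier F.carrier
  id _ := ⟨LinearMap.id, IsCompletelyBounded.id⟩
  comp f g := ⟨g.1 ∘ₗ f.1, IsCompletelyBounded.comp g.2 f.2⟩

instance OpSpace.preadditive : Preadditive OpSpace.{v} where
  homGroup E F := inferInstanceAs (AddCommGroup (cbMaps E.carrier F.carrier))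
  add_comp _ _ _ _ _ g := Subtype.ext (LinearMap.comp_add _ _ g.1)
  comp_add _ _ _ f _ _ := Subtype.ext (LinearMap.add_comp f.1 _ _)

/-! ## Operator algebras and their modules -/

/-- A unital operator algebra, described abstractly: a Banach algebra with a contractive unit and
with an operator space structure for which the multiplication is completely contractive on the
Haagerup tensor product, that is, every `M_n(A)` is submultiplicative. -/
class UnitalOperatorAlgebra (A : Type*) [NormedRing A] [NormedAlgebra ℂ A] [CompleteSpace A]
    extends OperatorSpace A where
  norm_one_le : ‖(1 : A)‖ ≤ 1
  mnorm_mul_le : ∀ (n : ℕ) (a b : Matrix (Fin n) (Fin n) A),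
    mnorm n (a * b) ≤ mnorm n a * mnorm n b

/-- Complete operator spaces that are unital right modules over a complex algebra `A`, the action
being bilinear. -/
structure OpSpaceModule (A : Type u) [Ring A] [Algebra ℂ A] extends OpSpace.{v} where
  [module : Module Aᵐᵒᵖ carrier]
  [isScalarTower : IsScalarTower ℂ Aᵐᵒᵖ carrier]

attribute [instance] OpSpaceModule.module OpSpaceModule.isScalarTower

section Modules

variable (A : Type u) [Ring A] [Algebra ℂ A]

instance OpSpaceModule.smulCommClass (E : OpSpaceModule.{u, v} A) :
    SMulCommClass ℂ Aᵐᵒᵖ E.carrier :=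
  IsScalarTower.to_smulCommClass

/-- The morphisms are the completely bounded `A`-module maps. -/
instance OpSpaceModule.category : Category.{v} (OpSpaceModule.{u, v} A) where
  Hom E F := cbModuleMaps E.carrier F.carrier A
  id _ := ⟨LinearMap.id, IsCompletelyBounded.id, fun _ _ => rfl⟩
  comp f g := ⟨g.1 ∘ₗ f.1, IsCompletelyBounded.comp g.2.1 f.2.1, fun a x => by
    rw [LinearMap.comp_apply, f.2.2 a x, g.2.2 a, LinearMap.comp_apply]⟩

instance OpSpaceModule.preadditive : Preadditive (OpSpaceModule.{u, v} A) where
  homGroup E F := inferInstanceAs (AddCommGroup (cbModuleMaps E.carrier F.carrier A))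
  add_comp _ _ _ _ _ g := Subtype.ext (LinearMap.comp_add _ _ g.1)
  comp_add _ _ _ f _ _ := Subtype.ext (LinearMap.add_comp f.1 _ _)

/-- The functor to `Op_∞` that forgets the module action. -/
def OpSpaceModule.forget : OpSpaceModule.{u, v} A ⥤ OpSpace.{v} where
  obj E := E.toOpSpace
  map f := ⟨f.1, f.2.1⟩

instance OpSpaceModule.forget_additive : (OpSpaceModule.forget.{u, v} A).Additive where
  map_add := rfl

end Modules

section OperatorModules

variable (A : Type u) [NormedRing A] [NormedAlgebra ℂ A] [CompleteSpace A]
  [UnitalOperatorAlgebra A]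

/-- `E` is a right operator `A`-module: the action is (multiplicatively) completely contractive,
`‖[∑ₖ x i k · a k j]‖ₙ ≤ ‖x‖ₙ ‖a‖ₙ`, that is, it induces a complete contraction on the Haagerup
tensor product of `E` and `A`. (Rectangular factorizations reduce to square ones by padding with
zeros.) -/
def IsOperatorModule : ObjectProperty (OpSpaceModule.{u, v} A) := fun E =>
  ∀ (n : ℕ) (x : Matrix (Fin n) (Fin n) E.carrier) (a : Matrix (Fin n) (Fin n) A),
    mnorm n (Matrix.of fun i j => ∑ k, MulOpposite.op (a k j) • x i k) ≤ mnorm n x * mnorm n a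

/-- `E` is a matrix normed right `A`-module: the action is jointly completely contractive,
`‖[x i j · a k l]‖ₙₘ ≤ ‖x‖ₙ ‖a‖ₘ`, that is, it induces a complete contraction on the operator space
projective tensor product of `E` and `A`. -/
def IsMatrixNormedModule : ObjectProperty (OpSpaceModule.{u, v} A) := fun E =>
  ∀ (n m : ℕ) (x : Matrix (Fin n) (Fin n) E.carrier) (a : Matrix (Fin m) (Fin m) A),
    mnorm (n * m) (Matrix.reindex finProdFinEquiv finProdFinEquiv
      (Matrix.of fun (p q : Fin n × Fin m) => MulOpposite.op (a p.2 q.2) • x p.1 q.1)) ≤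
        mnorm n x * mnorm m a

/-- The category of right operator `A`-modules and completely bounded `A`-module maps. -/
abbrev OMod := (IsOperatorModule.{u, v} A).FullSubcategory

/-- The category of matrix normed right `A`-modules and completely bounded `A`-module maps. -/
abbrev MnMod := (IsMatrixNormedModule.{u, v} A).FullSubcategory

/-- The forgetful functor from operator modules to operator spaces. -/
abbrev OMod.forget : OMod.{u, v} A ⥤ OpSpace.{v} :=
  (IsOperatorModule.{u, v} A).ι ⋙ OpSpaceModule.forget A

/-- The forgetful functor from matrix normed modules to operator spaces. -/
abbrev MnMod.forget : MnMod.{u, v} A ⥤ OpSpace.{v} :=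
  (IsMatrixNormedModule.{u, v} A).ι ⋙ OpSpaceModule.forget A

end OperatorModules

/-! ## Exact structures and injectivity -/

section Exact

variable {C D : Type*} [Category C] [Category D] [Preadditive C] [Preadditive D]

variable (C) in
/-- The maximal class: the pairs `(μ, π)` in which `μ` is a kernel of `π` and `π` is a cokernel
of `μ`. -/
def exactMax : ObjectProperty (ShortComplex C) := fun S =>
  Nonempty (IsLimit (KernelFork.ofι S.f S.zero)) ∧
    Nonempty (IsColimit (CokernelCofork.ofπ S.g S.zero))

/-- The relative class: the kernel-cokernel pairs that are split after applying the functor `F`. -/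
def exactRel (F : C ⥤ D) [F.Additive] : ObjectProperty (ShortComplex C) := fun S =>
  exactMax C S ∧ Nonempty (S.map F).Splitting

/-- The admissible monomorphisms of a class of kernel-cokernel pairs. -/
def admissibleMono (𝓔 : ObjectProperty (ShortComplex C)) : MorphismProperty C := fun _ Y μ =>
  ∃ (Z : C) (π : Y ⟶ Z) (w : μ ≫ π = 0), 𝓔 (ShortComplex.mk μ π w)

/-- `I` is injective with respect to the class `𝓔`: every morphism to `I` extends along every
admissible monomorphism. -/
def IsInjectiveFor (𝓔 : ObjectProperty (ShortComplex C)) (I : C) : Prop :=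
  ∀ ⦃X Y : C⦄ (μ : X ⟶ Y), admissibleMono 𝓔 μ → ∀ f : X ⟶ I, ∃ g : Y ⟶ I, μ ≫ g = f

end Exact

/-!
Let `(μ, π)` be a kernel-cokernel pair of modules and let `f` be a morphism from the source of `μ`
to `I`. Pushing the pair out along `f` gives `I ⟶ P ⟶ Z`, whose second map is a cokernel of the
first. The forgetful functor to operator spaces preserves `(μ, π)` and the pushout, so injectivity
of the operator space `I` extends `f` along `μ` and hence, by the universal property of the pushout,
gives a completely bounded retraction of `I ⟶ P`: the pushed-out pair splits in `Op_∞`. As the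
forgetful functor preserves kernels and reflects isomorphisms, it reflects kernels, so the
pushed-out pair belongs to the relative class of the module category. Relative injectivity now
retracts `I ⟶ P` by a module map, and composing with `Y ⟶ P` extends `f`.

The input from operator space theory is that kernels, cokernels and biproducts of modules are
computed on the underlying operator spaces: kernels are closed submodules, and cokernels are
quotients by closures of ranges with the quotient norms at every matrix level.
-/

section KernelCokernelPairs

theorem nonempty_isColimit_cokernelCofork_of_isPushout {C : Type*} [Category C]
    [HasZeroMorphisms C] {X Y Z I P : C} {f : X ⟶ Y} {h : X ⟶ I} {inl : Y ⟶ P} {inr : I ⟶ P}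
    (sq : IsPushout f h inl inr) {p : Y ⟶ Z} {w : f ≫ p = 0}
    (hp : IsColimit (CokernelCofork.ofπ p w)) {q : P ⟶ Z} (hl : inl ≫ q = p) (hr : inr ≫ q = 0) :
    Nonempty (IsColimit (CokernelCofork.ofπ q hr)) := by
  have : Epi p := epi_of_isColimit_cofork hp
  have : Epi (inl ≫ q) := by rwa [hl]
  have : Epi q := epi_of_epi inl q
  refine ⟨CokernelCofork.IsColimit.ofπ' q hr fun k hk => ?_⟩
  have hfk : f ≫ inl ≫ k = 0 := by rw [sq.w_assoc, hk, comp_zero]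
  obtain ⟨d, hd⟩ := CokernelCofork.IsColimit.desc' hp (inl ≫ k) hfk
  refine ⟨d, sq.hom_ext ?_ ?_⟩
  · rw [reassoc_of% hl]
    exact hd
  · rw [reassoc_of% hr, hk, zero_comp]

variable {C D : Type*} [Category C] [Category D] [Preadditive C] [Preadditive D]

theorem exactMax.map {F : C ⥤ D} [F.Additive]
    [∀ {X Y : C} (f : X ⟶ Y), PreservesLimit (parallelPair f 0) F]
    [∀ {X Y : C} (f : X ⟶ Y), PreservesColimit (parallelPair f 0) F]
    {S : ShortComplex C} (hS : exactMax C S) : exactMax D (S.map F) :=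
  ⟨hS.1.map (isLimitForkMapOfIsLimit' F S.zero),
    hS.2.map (isColimitCoforkMapOfIsColimit' F S.zero)⟩

theorem nonempty_splitting_of_retraction {S : ShortComplex C}
    (hg : IsColimit (CokernelCofork.ofπ S.g S.zero)) {r : S.X₂ ⟶ S.X₁} (hr : S.f ≫ r = 𝟙 S.X₁) :
    Nonempty S.Splitting := by
  have : Epi S.g := epi_of_isColimit_cofork hg
  have hf : S.f ≫ (𝟙 S.X₂ - r ≫ S.f) = 0 := by
    rw [Preadditive.comp_sub, reassoc_of% hr, Category.comp_id, sub_self]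
  obtain ⟨s, hs⟩ : ∃ s, S.g ≫ s = 𝟙 S.X₂ - r ≫ S.f :=
    ⟨_, (CokernelCofork.IsColimit.desc' hg _ hf).2⟩
  refine ⟨{ r := r, s := s, f_r := hr, s_g := ?_, id := by rw [hs, add_sub_cancel] }⟩
  rw [← cancel_epi S.g, reassoc_of% hs, Preadditive.sub_comp, Category.assoc, S.zero, comp_zero,
    sub_zero, Category.id_comp, Category.comp_id]

theorem isInjectiveFor_exactMax_of_exactRel [HasKernels C] [HasCokernels C]
    [HasBinaryBiproducts C] (F : C ⥤ D) [F.Additive] [F.ReflectsIsomorphisms]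
    [∀ {X Y : C} (f : X ⟶ Y), PreservesLimit (parallelPair f 0) F]
    [∀ {X Y : C} (f : X ⟶ Y), PreservesColimit (parallelPair f 0) F]
    {I : C} (hrel : IsInjectiveFor (exactRel F) I)
    (hmax : IsInjectiveFor (exactMax D) (F.obj I)) : IsInjectiveFor (exactMax C) I := by
  rintro X Y μ ⟨Z, p, w, hS⟩ f
  have := Preadditive.hasCoequalizers_of_hasCokernels (C := C)
  have := hasPushouts_of_hasBinaryCoproducts_of_hasCoequalizers C
  have : HasZeroObject C := ⟨_, isZero_kernel_of_mono (𝟙 I)⟩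
  have : HasZeroObject D := F.hasZeroObject_of_additive
  have := hasFiniteCoproducts_of_has_binary_and_initial (C := C)
  have := F.preservesFiniteColimits_of_preservesCokernels
  have sq := IsPushout.of_hasPushout μ f
  obtain ⟨q, hl, hr⟩ : ∃ q, pushout.inl μ f ≫ q = p ∧ pushout.inr μ f ≫ q = 0 :=
    sq.exists_desc p 0 (by rw [w, comp_zero])
  obtain ⟨hq⟩ := nonempty_isColimit_cokernelCofork_of_isPushout sq hS.2.some hl hr
  obtain ⟨g, hg⟩ := hmax (F.map μ) ⟨_, _, _, hS.map⟩ (F.map f)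
  have split : Nonempty ((ShortComplex.mk (pushout.inr μ f) q hr).map F).Splitting :=
    nonempty_splitting_of_retraction (isColimitCoforkMapOfIsColimit' F hr hq)
      ((sq.map F).inr_desc g (𝟙 _) (by rw [hg, Category.comp_id]))
  have : ReflectsLimit (parallelPair q 0) F := reflectsLimit_of_reflectsIsomorphisms _ _
  have hinr : IsLimit (KernelFork.ofι (pushout.inr μ f) hr) :=
    isLimitOfReflects F ((isLimitMapConeForkEquiv' F hr).symm split.some.fIsKernel)
  obtain ⟨r, hinr_r⟩ := hrel (pushout.inr μ f) ⟨Z, q, hr, ⟨⟨hinr⟩, ⟨hq⟩⟩, split⟩ (𝟙 I)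
  exact ⟨pushout.inl μ f ≫ r, by rw [sq.w_assoc, hinr_r, Category.comp_id]⟩

end KernelCokernelPairs

section QuotientSeminorm

variable {𝕜 V W : Type*} [NormedField 𝕜] [AddCommGroup V] [Module 𝕜 V] [AddCommGroup W]
  [Module 𝕜 W]

/-- `p'` is the quotient of the seminorm `p` along `q`. This is encoded by saying that the open
balls of `p'` around `0` are the images of the open balls of `p`, which avoids real infima and
forces `q` to be surjective. -/
def IsQuotientSeminorm (p : Seminorm 𝕜 V) (q : V →ₗ[𝕜] W) (p' : Seminorm 𝕜 W) : Prop :=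
  ∀ (w : W) (r : ℝ), p' w < r ↔ ∃ v, q v = w ∧ p v < r

namespace IsQuotientSeminorm

variable {p : Seminorm 𝕜 V} {q : V →ₗ[𝕜] W} {p' : Seminorm 𝕜 W}

theorem apply_le (h : IsQuotientSeminorm p q p') (v : V) : p' (q v) ≤ p v :=
  le_of_forall_gt fun r hr => (h (q v) r).2 ⟨v, rfl, hr⟩

theorem surjective (h : IsQuotientSeminorm p q p') : Function.Surjective q := fun w =>
  let ⟨v, hv, _⟩ := (h w (p' w + 1)).1 (lt_add_one _)
  ⟨v, hv⟩

theorem le_mul (h : IsQuotientSeminorm p q p') {w : W} {t B : ℝ} (hB : 0 ≤ B)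
    (hw : ∀ v, q v = w → t ≤ p v * B) : t ≤ p' w * B := by
  rcases hB.eq_or_lt with rfl | hB
  · obtain ⟨v, hv⟩ := h.surjective w
    simpa only [mul_zero] using hw v hv
  · by_contra! hlt
    obtain ⟨v, hv, hvlt⟩ := (h w (t / B)).1 ((lt_div_iff₀ hB).2 hlt)
    exact (hw v hv).not_gt ((lt_div_iff₀ hB).1 hvlt)

end IsQuotientSeminorm

/-- The quotient seminorm along a surjective linear map, the infimum of a seminorm over the
fibres. -/
noncomputable def quotientSeminorm (p : Seminorm 𝕜 V) (q : V →ₗ[𝕜] W)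
    (hq : Function.Surjective q) : Seminorm 𝕜 W :=
  have hbdd (w : W) : BddBelow (Set.range fun v : {v // q v = w} => p v) :=
    ⟨0, Set.forall_mem_range.2 fun _ => apply_nonneg p _⟩
  have hne (w : W) : Nonempty {v // q v = w} := nonempty_subtype.2 (hq w)
  Seminorm.ofSMulLE (fun w => ⨅ v : {v // q v = w}, p v)
    (le_antisymm ((ciInf_le (hbdd 0) ⟨0, map_zero q⟩).trans_eq (map_zero p))
      (Real.iInf_nonneg fun _ => apply_nonneg p _))
    (fun w w' => le_ciInf_add_ciInf fun v v' =>
      (ciInf_le (hbdd (w + w')) ⟨v + v', by rw [map_add, v.2, v'.2]⟩).trans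
        (map_add_le_add p _ _))
    (fun c w => by
      rw [Real.mul_iInf_of_nonneg (norm_nonneg c)]
      exact le_ciInf fun v => (ciInf_le (hbdd (c • w)) ⟨c • v, by rw [map_smul, v.2]⟩).trans_eq
        (map_smul_eq_mul p c _))

theorem isQuotientSeminorm_quotientSeminorm (p : Seminorm 𝕜 V) (q : V →ₗ[𝕜] W)
    (hq : Function.Surjective q) : IsQuotientSeminorm p q (quotientSeminorm p q hq) := fun w r => by
  have : Nonempty {v // q v = w} := nonempty_subtype.2 (hq w)
  have hbdd : BddBelow (Set.range fun v : {v // q v = w} => p v) :=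
    ⟨0, Set.forall_mem_range.2 fun _ => apply_nonneg p _⟩
  exact (ciInf_lt_iff hbdd).trans (by simp only [Subtype.exists, exists_prop])

end QuotientSeminorm

/-! ## Subspaces, products and quotients of operator spaces -/

open OperatorSpace (mnorm_one mnorm_sandwich_le mnorm_blockDiag)

section Matrices

variable {E F : Type*}

theorem scalarSandwich_map [AddCommGroup E] [Module ℂ E] [AddCommGroup F] [Module ℂ F]
    (f : E →ₗ[ℂ] F) {m n : ℕ} (α : Matrix (Fin m) (Fin n) ℂ) (x : Matrix (Fin n) (Fin n) E)
    (β : Matrix (Fin n) (Fin m) ℂ) :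
    (scalarSandwich α x β).map f = scalarSandwich α (x.map f) β := by
  ext i j
  simp [scalarSandwich, map_sum]

theorem mapMatrix_surjective {R : Type*} [Semiring R] [AddCommMonoid E] [Module R E]
    [AddCommMonoid F] [Module R F] {m n : Type*} {f : E →ₗ[R] F} (hf : Function.Surjective f) :
    Function.Surjective (f.mapMatrix (m := m) (n := n)) := fun z =>
  ⟨z.map (Function.surjInv hf), Matrix.ext fun _ _ => Function.surjInv_eq hf _⟩

variable [Zero E] [Zero F] {m n : ℕ} (x : Matrix (Fin m) (Fin m) E) (y : Matrix (Fin n) (Fin n) E)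

theorem blockDiag_map {f : E → F} (hf : f 0 = 0) :
    (blockDiag x y).map f = blockDiag (x.map f) (y.map f) := by
  simp only [blockDiag, Matrix.reindex_apply, ← Matrix.submatrix_map, Matrix.fromBlocks_map,
    Matrix.map_zero f hf]

theorem blockDiag_submatrix_castAdd :
    (blockDiag x y).submatrix (Fin.castAdd n) (Fin.castAdd n) = x := by
  ext i j
  simp [blockDiag]

theorem blockDiag_submatrix_natAdd :
    (blockDiag x y).submatrix (Fin.natAdd m) (Fin.natAdd m) = y := by
  ext i j
  simp [blockDiag]

open scoped Matrix Matrix.Norms.L2Operator in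
theorem l2_opNorm_le_one_of_conjTranspose_mul_self {𝕜 m n : Type*} [RCLike 𝕜] [Fintype m]
    [Fintype n] [DecidableEq n] {β : Matrix m n 𝕜} (hβ : βᴴ * β = 1) :
    ‖β‖ ≤ 1 := by
  classical
  have hone : ‖(1 : Matrix n n 𝕜)‖ ≤ 1 := by
    rw [← Matrix.diagonal_one, Matrix.l2_opNorm_diagonal]
    exact (pi_norm_const_le (1 : 𝕜)).trans_eq norm_one
  rw [← abs_norm, abs_le_one_iff_mul_self_le_one, ← Matrix.l2_opNorm_conjTranspose_mul_self, hβ]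
  exact hone

end Matrices

section OperatorSpaces

variable {E F G : Type*} [NormedAddCommGroup E] [NormedSpace ℂ E] [OperatorSpace E]
  [NormedAddCommGroup F] [NormedSpace ℂ F] [OperatorSpace F]
  [NormedAddCommGroup G] [NormedSpace ℂ G] [OperatorSpace G]

open scoped Matrix Matrix.Norms.L2Operator in
theorem mnorm_submatrix_le {m n : ℕ} {e : Fin m → Fin n} (he : Function.Injective e)
    (x : Matrix (Fin n) (Fin n) E) : mnorm m (x.submatrix e e) ≤ mnorm n x := by
  let β : Matrix (Fin n) (Fin m) ℂ := (1 : Matrix (Fin n) (Fin n) ℂ).submatrix id e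
  have hβ : ‖β‖ ≤ 1 := l2_opNorm_le_one_of_conjTranspose_mul_self <| by
    rw [Matrix.conjTranspose_submatrix, ← Matrix.submatrix_mul _ _ e id e Function.bijective_id,
      Matrix.conjTranspose_one, one_mul, Matrix.submatrix_one e he]
  have hx : scalarSandwich βᴴ x β = x.submatrix e e := by
    ext i j
    simp [scalarSandwich, β, Matrix.one_apply]
  calc mnorm m (x.submatrix e e) = mnorm m (scalarSandwich βᴴ x β) := by rw [hx]
    _ ≤ ‖βᴴ‖ * mnorm n x * ‖β‖ := mnorm_sandwich_le m n βᴴ x β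
    _ = mnorm n x * (‖β‖ * ‖β‖) := by rw [Matrix.l2_opNorm_conjTranspose]; ring
    _ ≤ mnorm n x := mul_le_of_le_one_right (apply_nonneg _ _)
        (mul_le_one₀ hβ (norm_nonneg β) hβ)

theorem IsCompletelyBounded.exists_nonneg {f : E →ₗ[ℂ] F} (hf : IsCompletelyBounded f) :
    ∃ C : ℝ, 0 ≤ C ∧ ∀ (n : ℕ) (x : Matrix (Fin n) (Fin n) E),
      mnorm n (x.map f) ≤ C * mnorm n x := by
  obtain ⟨C, hC⟩ := hf
  exact ⟨|C|, abs_nonneg C, fun n x => (hC n x).trans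
    (mul_le_mul_of_nonneg_right (le_abs_self C) (apply_nonneg _ _))⟩

theorem IsCompletelyBounded.continuous {f : E →ₗ[ℂ] F} (hf : IsCompletelyBounded f) :
    Continuous f := by
  obtain ⟨C, hC⟩ := hf
  refine AddMonoidHomClass.continuous_of_bound f C fun x => ?_
  rw [← mnorm_one, ← mnorm_one]
  exact hC 1 _

/-- A complete isometry: all amplifications to matrices are isometric. -/
def IsCompleteIsometry (i : E →ₗ[ℂ] F) : Prop :=
  ∀ (n : ℕ) (x : Matrix (Fin n) (Fin n) E), mnorm n (x.map i) = mnorm n x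

namespace IsCompleteIsometry

variable {i : E →ₗ[ℂ] F}

theorem isCompletelyBounded (hi : IsCompleteIsometry i) : IsCompletelyBounded i :=
  ⟨1, fun n x => by rw [hi n x, one_mul]⟩

theorem injective (hi : IsCompleteIsometry i) : Function.Injective i :=
  (AddMonoidHomClass.isometry_of_norm i fun x => by
    rw [← mnorm_one, ← mnorm_one]
    exact hi 1 _).injective

theorem exists_lift (hi : IsCompleteIsometry i) {k : G →ₗ[ℂ] F} (hk : IsCompletelyBounded k)
    (hrange : ∀ x, k x ∈ LinearMap.range i) :
    ∃ l : G →ₗ[ℂ] E, IsCompletelyBounded l ∧ i ∘ₗ l = k := by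
  let l := k.codRestrictOfInjective i hi.injective hrange
  have hl : i ∘ₗ l = k := LinearMap.codRestrictOfInjective_comp k i hi.injective hrange
  obtain ⟨C, hC⟩ := hk
  refine ⟨l, ⟨C, fun n x => ?_⟩, hl⟩
  calc mnorm n (x.map l) = mnorm n (x.map (i ∘ₗ l)) := (hi n (x.map l)).symm
    _ ≤ C * mnorm n x := by rw [hl]; exact hC n x

end IsCompleteIsometry

/-- A complete quotient map: at every matrix level the norm of the codomain is the quotient norm. -/
def IsCompleteQuotientMap (q : E →ₗ[ℂ] F) : Prop :=
  ∀ n : ℕ, IsQuotientSeminorm (mnorm n) (q.mapMatrix (m := Fin n) (n := Fin n)) (mnorm n)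

namespace IsCompleteQuotientMap

variable {q : E →ₗ[ℂ] F}

theorem mnorm_map_le (hq : IsCompleteQuotientMap q) {n : ℕ} (x : Matrix (Fin n) (Fin n) E) :
    mnorm n (x.map q) ≤ mnorm n x :=
  (hq n).apply_le x

theorem isCompletelyBounded (hq : IsCompleteQuotientMap q) : IsCompletelyBounded q :=
  ⟨1, fun _ x => (hq.mnorm_map_le x).trans_eq (one_mul _).symm⟩

theorem surjective (hq : IsCompleteQuotientMap q) : Function.Surjective q := fun z =>
  let ⟨y, hy⟩ := (hq 1).surjective (Matrix.of fun _ _ => z)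
  ⟨y 0 0, congrFun₂ hy 0 0⟩

theorem exists_desc (hq : IsCompleteQuotientMap q) {k : E →ₗ[ℂ] G} (hk : IsCompletelyBounded k)
    (hker : ∀ x, q x = 0 → k x = 0) :
    ∃ l : F →ₗ[ℂ] G, IsCompletelyBounded l ∧ l ∘ₗ q = k := by
  obtain ⟨s, hs⟩ := q.exists_rightInverse_of_surjective (LinearMap.range_eq_top.2 hq.surjective)
  have hl : (k ∘ₗ s) ∘ₗ q = k := LinearMap.ext fun x => sub_eq_zero.1 <| by
    rw [LinearMap.comp_apply, LinearMap.comp_apply, ← map_sub]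
    exact hker _ (by rw [map_sub, ← LinearMap.comp_apply, hs, LinearMap.id_apply, sub_self])
  obtain ⟨C, hC₀, hC⟩ := hk.exists_nonneg
  refine ⟨k ∘ₗ s, ⟨C, fun n z => ?_⟩, hl⟩
  rw [mul_comm]
  refine (hq n).le_mul hC₀ ?_
  rintro y rfl
  calc mnorm n ((y.map q).map (k ∘ₗ s)) = mnorm n (y.map ((k ∘ₗ s) ∘ₗ q)) := rfl
    _ ≤ mnorm n y * C := by rw [hl, mul_comm]; exact hC n y

end IsCompleteQuotientMap

open scoped Matrix.Norms.L2Operator in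
noncomputable instance OperatorSpace.instProd : OperatorSpace (E × F) where
  mnorm n := ((mnorm n).comp (LinearMap.mapMatrix (LinearMap.fst ℂ E F))) ⊔
    ((mnorm n).comp (LinearMap.mapMatrix (LinearMap.snd ℂ E F)))
  mnorm_one x := by
    rw [Prod.norm_def, ← mnorm_one x.1, ← mnorm_one x.2]
    rfl
  mnorm_sandwich_le m n α x β := by
    refine sup_le ?_ ?_
    · refine (congrArg (mnorm m) (scalarSandwich_map (LinearMap.fst ℂ E F) α x β)).trans_le
        ((mnorm_sandwich_le m n α _ β).trans ?_)
      gcongr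
      exact le_sup_left (α := ℝ)
    · refine (congrArg (mnorm m) (scalarSandwich_map (LinearMap.snd ℂ E F) α x β)).trans_le
        ((mnorm_sandwich_le m n α _ β).trans ?_)
      gcongr
      exact le_sup_right (α := ℝ)
  mnorm_blockDiag m n x y := by
    have hfst := (congrArg (mnorm (m + n)) (blockDiag_map x y (f := Prod.fst) rfl)).trans
      (mnorm_blockDiag m n _ _)
    have hsnd := (congrArg (mnorm (m + n)) (blockDiag_map x y (f := Prod.snd) rfl)).trans
      (mnorm_blockDiag m n _ _)
    exact (congrArg₂ max hfst hsnd).trans (max_max_max_comm _ _ _ _)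

theorem mnorm_prod {n : ℕ} (x : Matrix (Fin n) (Fin n) (E × F)) :
    mnorm n x = max (mnorm n (x.map Prod.fst)) (mnorm n (x.map Prod.snd)) :=
  rfl

theorem mnorm_prod_le_mul {m n : ℕ} {w : Matrix (Fin m) (Fin m) (E × F)}
    {x : Matrix (Fin n) (Fin n) (E × F)} {B : ℝ} (hB : 0 ≤ B)
    (hfst : mnorm m (w.map Prod.fst) ≤ mnorm n (x.map Prod.fst) * B)
    (hsnd : mnorm m (w.map Prod.snd) ≤ mnorm n (x.map Prod.snd) * B) :
    mnorm m w ≤ mnorm n x * B := by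
  rw [mnorm_prod, mnorm_prod, max_mul_of_nonneg _ _ hB]
  exact max_le_max hfst hsnd

theorem IsCompletelyBounded.fst : IsCompletelyBounded (LinearMap.fst ℂ E F) :=
  ⟨1, fun _ _ => (le_max_left _ _).trans_eq (one_mul _).symm⟩

theorem IsCompletelyBounded.snd : IsCompletelyBounded (LinearMap.snd ℂ E F) :=
  ⟨1, fun _ _ => (le_max_right _ _).trans_eq (one_mul _).symm⟩

theorem IsCompletelyBounded.prod {f : G →ₗ[ℂ] E} {g : G →ₗ[ℂ] F} (hf : IsCompletelyBounded f)
    (hg : IsCompletelyBounded g) : IsCompletelyBounded (f.prod g) := by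
  obtain ⟨C, hC⟩ := hf
  obtain ⟨D, hD⟩ := hg
  refine ⟨max C D, fun n x => max_le ((hC n x).trans ?_) ((hD n x).trans ?_)⟩
  · exact mul_le_mul_of_nonneg_right (le_max_left _ _) (apply_nonneg _ _)
  · exact mul_le_mul_of_nonneg_right (le_max_right _ _) (apply_nonneg _ _)

variable {R : Type*} [Ring R] [SMul ℂ R] [Module R E] [IsScalarTower ℂ R E] (K : Submodule R E)

noncomputable instance OperatorSpace.instSubmodule : OperatorSpace K where
  mnorm n := Seminorm.comp (mnorm n : Seminorm ℂ (Matrix (Fin n) (Fin n) E))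
    (LinearMap.mapMatrix (K.subtype.restrictScalars ℂ))
  mnorm_one x := mnorm_one (x : E)
  mnorm_sandwich_le m n α x β :=
    (congrArg (mnorm m) (scalarSandwich_map (K.subtype.restrictScalars ℂ) α x β)).trans_le
      (mnorm_sandwich_le m n α _ β)
  mnorm_blockDiag m n x y :=
    (congrArg (mnorm (m + n)) (blockDiag_map x y (f := K.subtype) rfl)).trans
      (mnorm_blockDiag m n _ _)

theorem isCompleteIsometry_subtype : IsCompleteIsometry (K.subtype.restrictScalars ℂ) :=
  fun _ _ => rfl

/-- The quotient seminorms on the matrices over `E ⧸ K`, before they are known to be the matrix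
norms of an operator space. -/
noncomputable def quotientMnorm (n : ℕ) : Seminorm ℂ (Matrix (Fin n) (Fin n) (E ⧸ K)) :=
  quotientSeminorm (mnorm n) (LinearMap.mapMatrix (K.mkQ.restrictScalars ℂ))
    (mapMatrix_surjective K.mkQ_surjective)

theorem isQuotientSeminorm_quotientMnorm (n : ℕ) : IsQuotientSeminorm (mnorm n)
    (LinearMap.mapMatrix (K.mkQ.restrictScalars ℂ)) (quotientMnorm K n) :=
  isQuotientSeminorm_quotientSeminorm _ _ _

theorem quotientMnorm_one (x : E ⧸ K) : quotientMnorm K 1 (Matrix.of fun _ _ => x) = ‖x‖ := by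
  refine eq_of_forall_gt_iff fun r =>
    (isQuotientSeminorm_quotientMnorm K 1 _ r).trans ⟨?_, fun hx => ?_⟩
  · rintro ⟨y, hy, hlt⟩
    obtain rfl : Submodule.Quotient.mk (y 0 0) = x := congrFun₂ hy 0 0
    have hy₀ : y = Matrix.of fun _ _ => y 0 0 := by
      ext i j
      rw [Subsingleton.elim i 0, Subsingleton.elim j 0]
      rfl
    rw [hy₀, mnorm_one] at hlt
    exact (Submodule.Quotient.norm_mk_le K _).trans_lt hlt
  · obtain ⟨v, rfl, hv⟩ := Submodule.Quotient.norm_mk_lt x (sub_pos.2 hx)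
    exact ⟨Matrix.of fun _ _ => v, rfl, by simpa only [mnorm_one, add_sub_cancel] using hv⟩

open scoped Matrix.Norms.L2Operator in
theorem quotientMnorm_sandwich_le (m n : ℕ) (α : Matrix (Fin m) (Fin n) ℂ)
    (x : Matrix (Fin n) (Fin n) (E ⧸ K)) (β : Matrix (Fin n) (Fin m) ℂ) :
    quotientMnorm K m (scalarSandwich α x β) ≤ ‖α‖ * quotientMnorm K n x * ‖β‖ := by
  rw [mul_right_comm, mul_comm]
  refine (isQuotientSeminorm_quotientMnorm K n).le_mul (by positivity) ?_
  rintro y rfl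
  calc quotientMnorm K m (scalarSandwich α (y.map (K.mkQ.restrictScalars ℂ)) β)
      = quotientMnorm K m ((scalarSandwich α y β).map (K.mkQ.restrictScalars ℂ)) := by
        rw [scalarSandwich_map]
    _ ≤ mnorm m (scalarSandwich α y β) := (isQuotientSeminorm_quotientMnorm K m).apply_le _
    _ ≤ ‖α‖ * mnorm n y * ‖β‖ := mnorm_sandwich_le m n α y β
    _ = mnorm n y * (‖α‖ * ‖β‖) := by ring

theorem quotientMnorm_blockDiag (m n : ℕ) (x : Matrix (Fin m) (Fin m) (E ⧸ K))
    (y : Matrix (Fin n) (Fin n) (E ⧸ K)) :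
    quotientMnorm K (m + n) (blockDiag x y) = max (quotientMnorm K m x) (quotientMnorm K n y) := by
  have hquot := isQuotientSeminorm_quotientMnorm K
  refine eq_of_forall_gt_iff fun r => ?_
  rw [max_lt_iff, hquot, hquot, hquot]
  constructor
  · rintro ⟨v, hv, hlt⟩
    refine ⟨⟨v.submatrix (Fin.castAdd n) (Fin.castAdd n), ?_,
        (mnorm_submatrix_le (Fin.castAdd_injective m n) v).trans_lt hlt⟩,
      ⟨v.submatrix (Fin.natAdd m) (Fin.natAdd m), ?_,
        (mnorm_submatrix_le (Fin.natAdd_injective n m) v).trans_lt hlt⟩⟩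
    · rw [← blockDiag_submatrix_castAdd x y, ← hv]
      rfl
    · rw [← blockDiag_submatrix_natAdd x y, ← hv]
      rfl
  · rintro ⟨⟨v, rfl, hv⟩, ⟨w, rfl, hw⟩⟩
    refine ⟨blockDiag v w, blockDiag_map v w (map_zero K.mkQ), ?_⟩
    rw [mnorm_blockDiag]
    exact max_lt hv hw

variable [IsClosed (K : Set E)]

noncomputable instance OperatorSpace.instQuotient : OperatorSpace (E ⧸ K) where
  mnorm := quotientMnorm K
  mnorm_one := quotientMnorm_one K
  mnorm_sandwich_le := quotientMnorm_sandwich_le K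
  mnorm_blockDiag := quotientMnorm_blockDiag K

theorem isCompleteQuotientMap_mkQ : IsCompleteQuotientMap (K.mkQ.restrictScalars ℂ) :=
  isQuotientSeminorm_quotientMnorm K

end OperatorSpaces

/-! ## Kernels and cokernels -/

namespace OpSpace

theorem nonempty_isLimit_kernelFork {K X Y : OpSpace.{v}} {i : K ⟶ X} {f : X ⟶ Y}
    (w : i ≫ f = 0) (hi : IsCompleteIsometry i.1)
    (hker : ∀ x, f.1 x = 0 → x ∈ LinearMap.range i.1) :
    Nonempty (IsLimit (KernelFork.ofι i w)) := by
  have : Mono i := ⟨fun a b hab => Subtype.ext <| LinearMap.ext fun x => hi.injective <|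
    LinearMap.congr_fun (congrArg Subtype.val hab) x⟩
  refine ⟨KernelFork.IsLimit.ofι' i w fun k hk => Classical.choice ?_⟩
  obtain ⟨l, hl, hil⟩ := hi.exists_lift k.2
    fun x => hker _ (LinearMap.congr_fun (congrArg Subtype.val hk) x)
  exact ⟨⟨l, hl⟩, Subtype.ext hil⟩

theorem nonempty_isColimit_cokernelCofork {X Y Q : OpSpace.{v}} {f : X ⟶ Y} {q : Y ⟶ Q}
    (w : f ≫ q = 0) (hq : IsCompleteQuotientMap q.1)
    (hker : ∀ y, q.1 y = 0 → y ∈ closure (Set.range f.1)) :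
    Nonempty (IsColimit (CokernelCofork.ofπ q w)) := by
  have : Epi q := ⟨fun a b hab => Subtype.ext <| LinearMap.ext <| hq.surjective.forall.2 fun x =>
    LinearMap.congr_fun (congrArg Subtype.val hab) x⟩
  refine ⟨CokernelCofork.IsColimit.ofπ' q w fun {W} k hk => Classical.choice ?_⟩
  have hclosure : closure (Set.range f.1) ⊆ {y | k.1 y = 0} :=
    closure_minimal (Set.range_subset_iff.2 (LinearMap.congr_fun (congrArg Subtype.val hk)))
      (isClosed_singleton.preimage k.2.continuous)
  obtain ⟨l, hl, hlq⟩ := hq.exists_desc k.2 fun y hy => hclosure (hker y hy)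
  exact ⟨⟨l, hl⟩, Subtype.ext hlq⟩

end OpSpace

namespace OpSpaceModule

section Algebra

variable {A : Type u} [Ring A] [Algebra ℂ A]

/-- A closed submodule, with the norms of the ambient module. -/
noncomputable abbrev sub (E : OpSpaceModule.{u, v} A) (K : Submodule Aᵐᵒᵖ E.carrier)
    [hK : IsClosed (K : Set E.carrier)] : OpSpaceModule.{u, v} A :=
  have : CompleteSpace K := hK.completeSpace_coe
  { carrier := K }

/-- The quotient by a closed submodule, with the quotient norms at every matrix level. -/
noncomputable abbrev quotient (E : OpSpaceModule.{u, v} A) (K : Submodule Aᵐᵒᵖ E.carrier)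
    [IsClosed (K : Set E.carrier)] : OpSpaceModule.{u, v} A :=
  { carrier := E.carrier ⧸ K }

/-- The product of two modules, with the maximum of the norms at every matrix level. -/
noncomputable abbrev prod (E F : OpSpaceModule.{u, v} A) : OpSpaceModule.{u, v} A :=
  { carrier := E.carrier × F.carrier }

/-- The inclusion of a closed submodule. -/
noncomputable def subι (E : OpSpaceModule.{u, v} A) (K : Submodule Aᵐᵒᵖ E.carrier)
    [IsClosed (K : Set E.carrier)] : E.sub K ⟶ E :=
  ⟨K.subtype.restrictScalars ℂ, (isCompleteIsometry_subtype K).isCompletelyBounded, fun _ _ => rfl⟩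

/-- The projection onto the quotient by a closed submodule. -/
noncomputable def quotientπ (E : OpSpaceModule.{u, v} A) (K : Submodule Aᵐᵒᵖ E.carrier)
    [IsClosed (K : Set E.carrier)] : E ⟶ E.quotient K :=
  ⟨K.mkQ.restrictScalars ℂ, (isCompleteQuotientMap_mkQ K).isCompletelyBounded, fun _ _ => rfl⟩

/-- The `A`-linear map underlying a morphism. -/
def toLinearMap {E F : OpSpaceModule.{u, v} A} (f : E ⟶ F) : E.carrier →ₗ[Aᵐᵒᵖ] F.carrier where
  toFun := f.1
  map_add' := f.1.map_add
  map_smul' a x := f.2.2 a.unop x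

instance isClosed_ker_toLinearMap {E F : OpSpaceModule.{u, v} A} (f : E ⟶ F) :
    IsClosed (LinearMap.ker (toLinearMap f) : Set E.carrier) :=
  isClosed_singleton.preimage f.2.1.continuous

instance forget_faithful : (forget.{u, v} A).Faithful where
  map_injective h := Subtype.ext (Subtype.mk.inj h)

theorem exists_forget_map_eq_of_injective {E F G : OpSpaceModule.{u, v} A} {i : E ⟶ F}
    (hi : Function.Injective i.1) {k : G ⟶ F} {l : (forget A).obj G ⟶ (forget A).obj E}
    (hl : l ≫ (forget A).map i = (forget A).map k) : ∃ l' : G ⟶ E, (forget A).map l' = l := by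
  let g : G.carrier →ₗ[ℂ] E.carrier := l.1
  have hig (x : G.carrier) : i.1 (g x) = k.1 x := LinearMap.congr_fun (congrArg Subtype.val hl) x
  refine ⟨⟨g, l.2, fun a x => hi ?_⟩, rfl⟩
  rw [hig, i.2.2, hig, k.2.2]

theorem exists_forget_map_eq_of_surjective {E F G : OpSpaceModule.{u, v} A} {q : E ⟶ F}
    (hq : Function.Surjective q.1) {k : E ⟶ G} {l : (forget A).obj F ⟶ (forget A).obj G}
    (hl : (forget A).map q ≫ l = (forget A).map k) : ∃ l' : F ⟶ G, (forget A).map l' = l := by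
  let g : F.carrier →ₗ[ℂ] G.carrier := l.1
  have hgq (x : E.carrier) : g (q.1 x) = k.1 x := LinearMap.congr_fun (congrArg Subtype.val hl) x
  refine ⟨⟨g, l.2, fun a => hq.forall.2 fun x => ?_⟩, rfl⟩
  rw [← q.2.2, hgq, hgq, k.2.2]

instance forget_reflectsIsomorphisms : (forget.{u, v} A).ReflectsIsomorphisms where
  reflects f _ := by
    have hleft : Function.LeftInverse (inv ((forget A).map f)).1 f.1 :=
      LinearMap.congr_fun (congrArg Subtype.val (IsIso.hom_inv_id ((forget A).map f)))
    obtain ⟨g, hg⟩ := exists_forget_map_eq_of_injective hleft.injective (k := 𝟙 _)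
      ((IsIso.inv_hom_id ((forget A).map f)).trans ((forget A).map_id _).symm)
    exact ⟨g, (forget A).map_injective (by simp [hg]), (forget A).map_injective (by simp [hg])⟩

variable {T : ObjectProperty (OpSpaceModule.{u, v} A)}

instance ι_comp_forget_reflectsIsomorphisms : (T.ι ⋙ forget A).ReflectsIsomorphisms :=
  have : T.ι.ReflectsIsomorphisms := reflectsIsomorphisms_of_full_and_faithful T.ι
  reflectsIsomorphisms_comp T.ι (forget A)

theorem nonempty_isLimit_of_isLimit_forget {K X Y : T.FullSubcategory} {i : K ⟶ X} {f : X ⟶ Y}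
    {w : i ≫ f = 0} (hi : Function.Injective i.hom.1)
    (h : IsLimit ((T.ι ⋙ forget A).mapCone (KernelFork.ofι i w))) :
    Nonempty (IsLimit (KernelFork.ofι i w)) := by
  have hforget := isLimitMapConeForkEquiv' (T.ι ⋙ forget A) w h
  have : Mono ((T.ι ⋙ forget A).map i) := mono_of_isLimit_fork hforget
  have : Mono i :=
    (Functor.reflectsMonomorphisms_of_faithful (T.ι ⋙ forget A)).reflects i this
  refine ⟨KernelFork.IsLimit.ofι' i w fun k hk => Classical.choice ?_⟩
  obtain ⟨l, hl⟩ := KernelFork.IsLimit.lift' hforget ((T.ι ⋙ forget A).map k)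
    (by rw [← Functor.map_comp, hk, Functor.map_zero])
  obtain ⟨l, rfl⟩ := exists_forget_map_eq_of_injective hi hl
  exact ⟨⟨l⟩, (T.ι ⋙ forget A).map_injective hl⟩

theorem nonempty_isColimit_of_isColimit_forget {X Y Q : T.FullSubcategory} {f : X ⟶ Y}
    {q : Y ⟶ Q} {w : f ≫ q = 0} (hq : Function.Surjective q.hom.1)
    (h : IsColimit ((T.ι ⋙ forget A).mapCocone (CokernelCofork.ofπ q w))) :
    Nonempty (IsColimit (CokernelCofork.ofπ q w)) := by
  have hforget := isColimitMapCoconeCoforkEquiv' (T.ι ⋙ forget A) w h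
  have : Epi ((T.ι ⋙ forget A).map q) := epi_of_isColimit_cofork hforget
  have : Epi q :=
    (Functor.reflectsEpimorphisms_of_faithful (T.ι ⋙ forget A)).reflects q this
  refine ⟨CokernelCofork.IsColimit.ofπ' q w fun k hk => Classical.choice ?_⟩
  obtain ⟨l, hl⟩ := CokernelCofork.IsColimit.desc' hforget ((T.ι ⋙ forget A).map k)
    (by rw [← Functor.map_comp, hk, Functor.map_zero])
  obtain ⟨l, rfl⟩ := exists_forget_map_eq_of_surjective hq hl
  exact ⟨⟨l⟩, (T.ι ⋙ forget A).map_injective hl⟩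

/-- A class of modules with continuous action that is stable under closed submodules, quotients by
closed submodules and binary products, so that the full subcategory it spans has kernels, cokernels
and biproducts computed on the underlying operator spaces. -/
structure IsStable (T : ObjectProperty (OpSpaceModule.{u, v} A)) : Prop where
  continuousConstSMul {E : OpSpaceModule.{u, v} A} : T E → ContinuousConstSMul Aᵐᵒᵖ E.carrier
  of_isCompleteIsometry {E F : OpSpaceModule.{u, v} A} (i : E ⟶ F) :
    IsCompleteIsometry i.1 → T F → T E
  of_isCompleteQuotientMap {E F : OpSpaceModule.{u, v} A} (q : E ⟶ F) :
    IsCompleteQuotientMap q.1 → T E → T F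
  prod {E F : OpSpaceModule.{u, v} A} : T E → T F → T (E.prod F)

namespace IsStable

theorem exists_kernel (hT : IsStable T) {X Y : T.FullSubcategory} (f : X ⟶ Y) :
    ∃ (K : T.FullSubcategory) (i : K ⟶ X) (w : i ≫ f = 0),
      Nonempty (IsLimit (KernelFork.ofι i w)) ∧
      Nonempty (IsLimit ((T.ι ⋙ forget A).mapCone (KernelFork.ofι i w))) := by
  let ι := X.obj.subι (LinearMap.ker (toLinearMap f.hom))
  have hι : IsCompleteIsometry ι.1 := isCompleteIsometry_subtype _
  let i : (⟨_, hT.of_isCompleteIsometry ι hι X.property⟩ : T.FullSubcategory) ⟶ X := ⟨ι⟩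
  have w : i ≫ f = 0 := ObjectProperty.hom_ext _ <| Subtype.ext <| LinearMap.ext fun x => x.2
  obtain ⟨h⟩ := OpSpace.nonempty_isLimit_kernelFork (f := (T.ι ⋙ forget A).map f)
    (i := (T.ι ⋙ forget A).map i) (by rw [← Functor.map_comp, w, Functor.map_zero]) hι
    fun x hx => ⟨⟨x, hx⟩, rfl⟩
  have hforget := (isLimitMapConeForkEquiv' (T.ι ⋙ forget A) w).symm h
  exact ⟨_, i, w, nonempty_isLimit_of_isLimit_forget hι.injective hforget, ⟨hforget⟩⟩

theorem exists_cokernel (hT : IsStable T) {X Y : T.FullSubcategory} (f : X ⟶ Y) :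
    ∃ (Q : T.FullSubcategory) (q : Y ⟶ Q) (w : f ≫ q = 0),
      Nonempty (IsColimit (CokernelCofork.ofπ q w)) ∧
      Nonempty (IsColimit ((T.ι ⋙ forget A).mapCocone (CokernelCofork.ofπ q w))) := by
  have := hT.continuousConstSMul Y.property
  let S := (LinearMap.range (toLinearMap f.hom)).topologicalClosure
  have : IsClosed (S : Set Y.obj.carrier) := Submodule.isClosed_topologicalClosure _
  let π := Y.obj.quotientπ S
  have hπ : IsCompleteQuotientMap π.1 := isCompleteQuotientMap_mkQ S
  let q : Y ⟶ (⟨_, hT.of_isCompleteQuotientMap π hπ Y.property⟩ : T.FullSubcategory) := ⟨π⟩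
  have w : f ≫ q = 0 := ObjectProperty.hom_ext _ <| Subtype.ext <| LinearMap.ext fun x =>
    (Submodule.Quotient.mk_eq_zero S).2 (Submodule.le_topologicalClosure _ ⟨x, rfl⟩)
  obtain ⟨h⟩ := OpSpace.nonempty_isColimit_cokernelCofork (f := (T.ι ⋙ forget A).map f)
    (q := (T.ι ⋙ forget A).map q) (by rw [← Functor.map_comp, w, Functor.map_zero]) hπ
    fun y => (Submodule.Quotient.mk_eq_zero S).1
  have hforget := (isColimitMapCoconeCoforkEquiv' (T.ι ⋙ forget A) w).symm h
  exact ⟨_, q, w, nonempty_isColimit_of_isColimit_forget hπ.surjective hforget, ⟨hforget⟩⟩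

theorem hasKernels (hT : IsStable T) : HasKernels T.FullSubcategory where
  has_limit f :=
    let ⟨_, _, _, ⟨h⟩, _⟩ := hT.exists_kernel f
    ⟨_, h⟩

theorem hasCokernels (hT : IsStable T) : HasCokernels T.FullSubcategory where
  has_colimit f :=
    let ⟨_, _, _, ⟨h⟩, _⟩ := hT.exists_cokernel f
    ⟨_, h⟩

theorem preservesKernel (hT : IsStable T) {X Y : T.FullSubcategory} (f : X ⟶ Y) :
    PreservesLimit (parallelPair f 0) (T.ι ⋙ forget A) :=
  let ⟨_, _, _, ⟨h⟩, ⟨hforget⟩⟩ := hT.exists_kernel f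
  preservesLimit_of_preserves_limit_cone h hforget

theorem preservesCokernel (hT : IsStable T) {X Y : T.FullSubcategory} (f : X ⟶ Y) :
    PreservesColimit (parallelPair f 0) (T.ι ⋙ forget A) :=
  let ⟨_, _, _, ⟨h⟩, ⟨hforget⟩⟩ := hT.exists_cokernel f
  preservesColimit_of_preserves_colimit_cocone h hforget

theorem hasBinaryBiproducts (hT : IsStable T) : HasBinaryBiproducts T.FullSubcategory where
  has_binary_biproduct X Y := hasBinaryBiproduct_of_total
    { pt := ⟨X.obj.prod Y.obj, hT.prod X.property Y.property⟩
      fst := ⟨LinearMap.fst ℂ _ _, .fst, fun _ _ => rfl⟩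
      snd := ⟨LinearMap.snd ℂ _ _, .snd, fun _ _ => rfl⟩
      inl := ⟨LinearMap.inl ℂ _ _, .prod .id .zero, fun a _ =>
        Prod.ext rfl (smul_zero (MulOpposite.op a)).symm⟩
      inr := ⟨LinearMap.inr ℂ _ _, .prod .zero .id, fun a _ =>
        Prod.ext (smul_zero (MulOpposite.op a)).symm rfl⟩
      inl_fst := rfl
      inl_snd := rfl
      inr_fst := rfl
      inr_snd := rfl } <|
    ObjectProperty.hom_ext _ <| Subtype.ext <| LinearMap.ext fun x =>
      Prod.ext (add_zero x.1) (zero_add x.2)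

end IsStable

end Algebra

/-! ## Operator modules and matrix normed modules -/

section Actions

variable {A E F : Type*} [Semiring A] [AddCommMonoid E] [Module Aᵐᵒᵖ E] [AddCommMonoid F]
  [Module Aᵐᵒᵖ F]

/-- The matrix product `[∑ₖ x i k · a k j]`, which is the action on the Haagerup tensor product at
level `n`. -/
def matrixSMul {n : ℕ} (x : Matrix (Fin n) (Fin n) E) (a : Matrix (Fin n) (Fin n) A) :
    Matrix (Fin n) (Fin n) E :=
  Matrix.of fun i j => ∑ k, MulOpposite.op (a k j) • x i k

/-- The Kronecker product `[x i j · a k l]`, which is the action on the projective tensor product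
at level `n * m`. -/
def kroneckerSMul {n m : ℕ} (x : Matrix (Fin n) (Fin n) E) (a : Matrix (Fin m) (Fin m) A) :
    Matrix (Fin (n * m)) (Fin (n * m)) E :=
  Matrix.reindex finProdFinEquiv finProdFinEquiv
    (Matrix.of fun (p q : Fin n × Fin m) => MulOpposite.op (a p.2 q.2) • x p.1 q.1)

theorem matrixSMul_map (f : E →ₗ[Aᵐᵒᵖ] F) {n : ℕ} (x : Matrix (Fin n) (Fin n) E)
    (a : Matrix (Fin n) (Fin n) A) : (matrixSMul x a).map f = matrixSMul (x.map f) a := by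
  ext i j
  simp [matrixSMul, map_sum]

theorem kroneckerSMul_map (f : E →ₗ[Aᵐᵒᵖ] F) {n m : ℕ} (x : Matrix (Fin n) (Fin n) E)
    (a : Matrix (Fin m) (Fin m) A) : (kroneckerSMul x a).map f = kroneckerSMul (x.map f) a := by
  ext i j
  simp [kroneckerSMul]

theorem matrixSMul_one (x : E) (a : A) :
    matrixSMul (Matrix.of fun _ _ : Fin 1 => x) (Matrix.of fun _ _ => a) =
      Matrix.of fun _ _ => MulOpposite.op a • x := by
  ext i j
  simp [matrixSMul]

theorem kroneckerSMul_one (x : E) (a : A) :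
    kroneckerSMul (Matrix.of fun _ _ : Fin 1 => x) (Matrix.of fun _ _ : Fin 1 => a) =
      Matrix.of fun _ _ => MulOpposite.op a • x :=
  rfl

end Actions

theorem continuousConstSMul_of_norm_smul_le {A E : Type*} [NormedRing A]
    [SeminormedAddCommGroup E] [Module Aᵐᵒᵖ E]
    (h : ∀ (a : A) (x : E), ‖MulOpposite.op a • x‖ ≤ ‖x‖ * ‖a‖) : ContinuousConstSMul Aᵐᵒᵖ E where
  continuous_const_smul a := AddMonoidHomClass.continuous_of_bound
    (DistribSMul.toAddMonoidHom E a) ‖a.unop‖ fun x => (h a.unop x).trans_eq (mul_comm _ _)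

section OperatorAlgebra

variable {A : Type u} [NormedRing A] [NormedAlgebra ℂ A] [CompleteSpace A]
  [UnitalOperatorAlgebra A]

theorem isOperatorModule_iff {E : OpSpaceModule.{u, v} A} : IsOperatorModule A E ↔
    ∀ (n : ℕ) (x : Matrix (Fin n) (Fin n) E.carrier) (a : Matrix (Fin n) (Fin n) A),
      mnorm n (matrixSMul x a) ≤ mnorm n x * mnorm n a :=
  Iff.rfl

theorem isMatrixNormedModule_iff {E : OpSpaceModule.{u, v} A} : IsMatrixNormedModule A E ↔
    ∀ (n m : ℕ) (x : Matrix (Fin n) (Fin n) E.carrier) (a : Matrix (Fin m) (Fin m) A),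
      mnorm (n * m) (kroneckerSMul x a) ≤ mnorm n x * mnorm m a :=
  Iff.rfl

variable (A)

theorem isStable_isOperatorModule : IsStable (IsOperatorModule.{u, v} A) where
  continuousConstSMul hE := continuousConstSMul_of_norm_smul_le fun a x => by
    simpa only [matrixSMul_one, mnorm_one] using
      isOperatorModule_iff.1 hE 1 (Matrix.of fun _ _ => x) (Matrix.of fun _ _ => a)
  of_isCompleteIsometry {E F} i hi hF := isOperatorModule_iff.2 fun n x a => by
    rw [← hi n x, ← hi]
    exact (congrArg (mnorm n) (matrixSMul_map (toLinearMap i) x a)).trans_le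
      (isOperatorModule_iff.1 hF n _ a)
  of_isCompleteQuotientMap q hq hE := isOperatorModule_iff.2 fun n _ a =>
    (hq n).le_mul (apply_nonneg _ _) <| by
      rintro y rfl
      exact (congrArg (mnorm n) (matrixSMul_map (toLinearMap q) y a)).symm.trans_le
        ((hq.mnorm_map_le _).trans (isOperatorModule_iff.1 hE n y a))
  prod {E F} hE hF := isOperatorModule_iff.2 fun n x a =>
    mnorm_prod_le_mul (apply_nonneg _ _)
      ((congrArg (mnorm n) (matrixSMul_map (LinearMap.fst Aᵐᵒᵖ _ _) x a)).trans_le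
        (isOperatorModule_iff.1 hE n _ a))
      ((congrArg (mnorm n) (matrixSMul_map (LinearMap.snd Aᵐᵒᵖ _ _) x a)).trans_le
        (isOperatorModule_iff.1 hF n _ a))

theorem isStable_isMatrixNormedModule : IsStable (IsMatrixNormedModule.{u, v} A) where
  continuousConstSMul hE := continuousConstSMul_of_norm_smul_le fun a x => by
    have h := isMatrixNormedModule_iff.1 hE 1 1 (Matrix.of fun _ _ => x) (Matrix.of fun _ _ => a)
    rw [kroneckerSMul_one, mnorm_one x, mnorm_one a] at h
    exact (mnorm_one _).symm.trans_le h
  of_isCompleteIsometry {E F} i hi hF := isMatrixNormedModule_iff.2 fun n m x a => by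
    rw [← hi n x, ← hi]
    exact (congrArg (mnorm (n * m)) (kroneckerSMul_map (toLinearMap i) x a)).trans_le
      (isMatrixNormedModule_iff.1 hF n m _ a)
  of_isCompleteQuotientMap q hq hE := isMatrixNormedModule_iff.2 fun n m _ a =>
    (hq n).le_mul (apply_nonneg _ _) <| by
      rintro y rfl
      exact (congrArg (mnorm (n * m)) (kroneckerSMul_map (toLinearMap q) y a)).symm.trans_le
        ((hq.mnorm_map_le _).trans (isMatrixNormedModule_iff.1 hE n m y a))
  prod {E F} hE hF := isMatrixNormedModule_iff.2 fun n m x a =>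
    mnorm_prod_le_mul (apply_nonneg _ _)
      ((congrArg (mnorm (n * m)) (kroneckerSMul_map (LinearMap.fst Aᵐᵒᵖ _ _) x a)).trans_le
        (isMatrixNormedModule_iff.1 hE n m _ a))
      ((congrArg (mnorm (n * m)) (kroneckerSMul_map (LinearMap.snd Aᵐᵒᵖ _ _) x a)).trans_le
        (isMatrixNormedModule_iff.1 hF n m _ a))

end OperatorAlgebra

end OpSpaceModule

open OpSpaceModule in
theorem mainTheorem9_general {A : Type u} [Ring A] [Algebra ℂ A]
    {T : ObjectProperty (OpSpaceModule.{u, v} A)} (hT : IsStable T) {E : T.FullSubcategory}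
    (hrel : IsInjectiveFor (exactRel (T.ι ⋙ forget A)) E)
    (hmax : IsInjectiveFor (exactMax OpSpace.{v}) ((T.ι ⋙ forget A).obj E)) :
    IsInjectiveFor (exactMax T.FullSubcategory) E := by
  have := hT.hasKernels
  have := hT.hasCokernels
  have := hT.hasBinaryBiproducts
  have : ∀ {X Y : T.FullSubcategory} (f : X ⟶ Y),
      PreservesLimit (parallelPair f 0) (T.ι ⋙ forget A) := hT.preservesKernel
  have : ∀ {X Y : T.FullSubcategory} (f : X ⟶ Y),
      PreservesColimit (parallelPair f 0) (T.ι ⋙ forget A) := hT.preservesCokernel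
  exact isInjectiveFor_exactMax_of_exactRel (T.ι ⋙ forget A) hrel hmax

theorem mainTheorem9 (A : Type u) [NormedRing A] [NormedAlgebra ℂ A] [CompleteSpace A]
    [UnitalOperatorAlgebra A] :
    (∀ E : OMod.{u, v} A,
      IsInjectiveFor (exactRel (OMod.forget.{u, v} A)) E →
      IsInjectiveFor (exactMax OpSpace.{v}) ((OMod.forget.{u, v} A).obj E) →
      IsInjectiveFor (exactMax (OMod.{u, v} A)) E) ∧
    (∀ E : MnMod.{u, v} A,
      IsInjectiveFor (exactRel (MnMod.forget.{u, v} A)) E →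
      IsInjectiveFor (exactMax OpSpace.{v}) ((MnMod.forget.{u, v} A).obj E) →
      IsInjectiveFor (exactMax (MnMod.{u, v} A)) E) :=
  ⟨fun _ => mainTheorem9_general (OpSpaceModule.isStable_isOperatorModule A),
    fun _ => mainTheorem9_general (OpSpaceModule.isStable_isMatrixNormedModule A)⟩
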